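/- **Count-free Weisfeiler–Leman.** Let $k\ge 0$. Count-free refinement of a coloring $\chi_0$ of the $k$-tuples over a set $X$ is given by $$\chi_{r+1}(t)=\bigl(\chi_r(t),\ \{(\chi_r(t(t_1/x)),\dots,\chi_r(t(t_k/x))) : x\in X\}\bigr),$$ where $t(t_i/x)$ is $t$ with its $i$-th entry replaced by $x$ and $\{\cdot\}$ is a set (not a multiset). For a finite group $G$ the three versions of $k$-dimensional count-free WL use the following initial colorings. * Version I ($X=G$): $\bar g\in G^k$ and $\bar h\in H^k$ get the same initial color iff for all $i,j,\ell$: $g_ig_j=g_\ell\Leftrightarrow h_ih_j=h_\ell$ and $g_i=g_j\Leftrightarrow h_i=h_j$. * Version II ($X=G$): $\bar g$ and $\bar h$ get the same initial color iff $g_i\mapsto h_i$ ($1\le i\le k$) extends to an isomorphism $\langle g_1,\dots,g_k\rangle\cong\langle h_1,\dots,h_k\rangle$. * Version III ($X=V(\Gamma_G)$): $\Gamma_G$ is the simple graph whose vertices are the elements of $G$ and, for each $(g,h)\in G^2$, four further vertices $a_{gh},b_{gh},c_{gh},d_{gh}$, with the edges $\{g,a_{gh}\},\{h,b_{gh}\},\{gh,d_{gh}\},\{a_{gh},b_{gh}\},\{b_{gh},c_{gh}\},\{c_{gh},d_{gh}\}$;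 tuples $\bar u\in V(\Gamma_G)^k$ and $\bar v\in V(\Gamma_H)^k$ get the same initial color iff for all $i,j$: $u_i\sim u_j\Leftrightarrow v_i\sim v_j$ and $u_i=u_j\Leftrightarrow v_i=v_j$. The algorithm *distinguishes* $G$ from $H$ if $|G|\ne|H|$ or if after some number $r\geq 0$ of refinement steps the sets of colors of the $k$-tuples for $G$ and for $H$ differ. It *identifies* $G$ if it distinguishes $G$ from every finite group not isomorphic to $G$. **Theorem.** For $n\ge5$ let $G_n=(\mathbb Z/2\mathbb Z)^n\times(\mathbb Z/4\mathbb Z)^n$ and $H_n=(\mathbb Z/2\mathbb Z)^{n-2}\times(\mathbb Z/4\mathbb Z)^{n+1}$. 1. For every $n\ge5$, $|G_n|=|H_n|$ and $G_n\not\cong H_n$, and for every integer $0\le k\le n/4$ the $k$-dimensional count-free WL Version II algorithm does not distinguish $G_n$ from $H_n$. 2. Consequently count-free WL needs dimension $\Omega(\log|G|)$ to identify Abelian groups: there is a constant $c>0$ such that for all $n\ge5$, each of the Versions I, II, III and all $k\ge 0$, if $k$-dimensional count-free WL of that version distinguishes $G_n$ from $H_n$, or identifies $G_n$, or identifies $H_n$,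 then $k\ge c\log|G_n|=c\log|H_n|$. -/

import Mathlib

namespace CountFreeWL

universe u v

/-! ### Count-free refinement of colorings of `k`-tuples -/

/-- The colors available after `r` refinement steps, starting from a type `C` of initial colors:
a refined color is the old color together with a *set* of `k`-tuples of old colors. -/
def Color (k : ℕ) (C : Type v) : ℕ → Type v
  | 0 => C
  | r + 1 => Color k C r × Set (Fin k → Color k C r)

/-- The coloring `χ_r` of `k`-tuples over `X` after `r` count-free refinement steps from `χ₀`:
`χ_{r+1}(t) = (χ_r(t), {(χ_r(t(t₁/x)), …, χ_r(t(t_k/x))) | x ∈ X})`. -/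
def color {X : Type u} {C : Type v} {k : ℕ} (χ₀ : (Fin k → X) → C) :
    (r : ℕ) → (Fin k → X) → Color k C r
  | 0 => χ₀
  | r + 1 => fun t =>
      (color χ₀ r t, Set.range fun (x : X) (i : Fin k) => color χ₀ r (Function.update t i x))

/-- After some number of count-free refinement steps, the *sets* of colors of the `k`-tuples
over `X` and over `Y` differ. -/
def ColorSetsDiffer {X Y : Type u} {C : Type v} {k : ℕ}
    (χX : (Fin k → X) → C) (χY : (Fin k → Y) → C) : Prop :=
  ∃ r : ℕ, Set.range (color χX r) ≠ Set.range (color χY r)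

/-! ### Version I -/

/-- The initial color of Version I records which products `g_i g_j = g_l` and which
equalities `g_i = g_j` hold. -/
def initialColorI (k : ℕ) (G : Type u) [Group G] (g : Fin k → G) :
    (Fin k → Fin k → Fin k → Prop) × (Fin k → Fin k → Prop) :=
  (fun i j l => g i * g j = g l, fun i j => g i = g j)

/-! ### Version II -/

/-- The map `g_i ↦ h_i` extends to an isomorphism `⟨g_1, …, g_k⟩ ≃ ⟨h_1, …, h_k⟩`. -/
def MarkedIso {k : ℕ} {G H : Type u} [Group G] [Group H] (g : Fin k → G) (h : Fin k → H) :
    Prop :=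
  ∃ φ : Subgroup.closure (Set.range g) ≃* Subgroup.closure (Set.range h),
    ∀ i, φ ⟨g i, Subgroup.subset_closure (Set.mem_range_self i)⟩ =
      ⟨h i, Subgroup.subset_closure (Set.mem_range_self i)⟩

/-- A group together with a `k`-tuple of its elements. -/
structure MarkedGroup (k : ℕ) : Type (u + 1) where
  carrier : Type u
  [group : Group carrier]
  tuple : Fin k → carrier

attribute [instance] MarkedGroup.group

/-- Marked isomorphism is an equivalence relation. -/
instance markedSetoid (k : ℕ) : Setoid (MarkedGroup.{u} k) where
  r M N := MarkedIso M.tuple N.tuple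
  iseqv :=
    { refl := fun _ => ⟨MulEquiv.refl _, fun _ => rfl⟩
      symm := by
        rintro _ _ ⟨φ, hφ⟩
        exact ⟨φ.symm, fun i => by rw [← hφ i, MulEquiv.symm_apply_apply]⟩
      trans := by
        rintro _ _ _ ⟨φ, hφ⟩ ⟨ψ, hψ⟩
        exact ⟨φ.trans ψ, fun i => by rw [MulEquiv.trans_apply, hφ i, hψ i]⟩ }

/-- The initial color of Version II is the marked isomorphism type of the tuple. -/
def initialColorII (k : ℕ) (G : Type u) [Group G] (g : Fin k → G) :
    Quotient (markedSetoid.{u} k) :=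
  Quotient.mk _ ⟨G, g⟩

/-- Two tuples have the same Version II initial color iff they are marked isomorphic. -/
theorem initialColorII_eq_iff {k : ℕ} {G H : Type u} [Group G] [Group H]
    (g : Fin k → G) (h : Fin k → H) :
    initialColorII k G g = initialColorII k H h ↔ MarkedIso g h :=
  Quotient.eq

/-! ### Version III -/

/-- Vertices of `Γ_G`: the group elements, and for each pair `(g, h)` the four further vertices
`a, b, c, d` of the multiplication gadget `M(g, h)`. -/
inductive GadgetVertex (G : Type u) : Type u
  | elt (g : G)
  | a (g h : G)
  | b (g h : G)
  | c (g h : G)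
  | d (g h : G)

/-- The edges of the multiplication gadgets, each listed in one orientation. -/
inductive GadgetEdge {G : Type u} [Group G] : GadgetVertex G → GadgetVertex G → Prop
  | left (g h : G) : GadgetEdge (.elt g) (.a g h)
  | right (g h : G) : GadgetEdge (.elt h) (.b g h)
  | prod (g h : G) : GadgetEdge (.elt (g * h)) (.d g h)
  | ab (g h : G) : GadgetEdge (.a g h) (.b g h)
  | bc (g h : G) : GadgetEdge (.b g h) (.c g h)
  | cd (g h : G) : GadgetEdge (.c g h) (.d g h)

/-- The simple undirected graph `Γ_G` that encodes the multiplication table of `G`. -/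
def gadgetGraph (G : Type u) [Group G] : SimpleGraph (GadgetVertex G) :=
  SimpleGraph.fromRel GadgetEdge

/-- The initial color of Version III, for tuples of vertices of `Γ_G`, records which adjacencies
and which equalities hold among the entries. -/
def initialColorIII (k : ℕ) (G : Type u) [Group G] (t : Fin k → GadgetVertex G) :
    (Fin k → Fin k → Prop) × (Fin k → Fin k → Prop) :=
  (fun i j => (gadgetGraph G).Adj (t i) (t j), fun i j => t i = t j)

/-! ### Distinguishing and identifying groups -/

/-- The three versions of the Weisfeiler-Leman algorithm for groups. -/
inductive Version
  | I
  | II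
  | III

/-- `k`-dimensional count-free WL (in the given version) distinguishes `G` from `H`. Groups of
different orders count as distinguished. -/
def Distinguishes (J : Version) (k : ℕ) (G H : Type u) [Group G] [Group H] : Prop :=
  Nat.card G ≠ Nat.card H ∨
    match J with
    | .I => ColorSetsDiffer (initialColorI k G) (initialColorI k H)
    | .II => ColorSetsDiffer (initialColorII k G) (initialColorII k H)
    | .III => ColorSetsDiffer (initialColorIII k G) (initialColorIII k H)

/-- `k`-dimensional count-free WL identifies the finite group `G`: it distinguishes `G` from every
finite group that is not isomorphic to `G`. -/
def Identifies (J : Version) (k : ℕ) (G : Type u) [Group G] : Prop :=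
  ∀ (H : Type u) [Group H] [Finite H], IsEmpty (G ≃* H) → Distinguishes J k G H

/-! ### The two families of groups -/

/-- `(ℤ/2)^m × (ℤ/4)^l`, written multiplicatively. -/
abbrev TwoFourGroup (m l : ℕ) : Type :=
  Multiplicative ((Fin m → ZMod 2) × (Fin l → ZMod 4))

/-- `G_n = (ℤ/2)^n × (ℤ/4)^n`. -/
abbrev GroupG (n : ℕ) : Type := TwoFourGroup n n

/-- `H_n = (ℤ/2)^(n-2) × (ℤ/4)^(n+1)`, used for `n ≥ 5` only. -/
abbrev GroupH (n : ℕ) : Type := TwoFourGroup (n - 2) (n + 1)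

end CountFreeWL

/-! Both groups have the direct factor A = (ℤ/2)^(n-2) × (ℤ/4)^n, with complement P = (ℤ/2)² in G_n
and Q = ℤ/4 in H_n. Two tuples are kept indistinguishable as long as they are images of one tuple
over A under embeddings as a direct factor: such embeddings preserve all three initial colors. To
answer a new point of A × P, an automorphism fixing the current tuple moves that point into A, where
it has a counterpart in H_n; Q is treated likewise. The automorphism (`swapSummand`) exchanges a
cyclic summand of P with one of A that a split functional cuts out. If few elements of A are in
play, pigeonhole gives such a functional vanishing on all of them (`exists_functional`). Counting is
invisible to this argument, so the different numbers of solutions of x² = 1 in the two groups go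
undetected. -/

namespace CountFreeWL

/-! ### Back and forth -/

section BackAndForth

variable {X Y Z : Type*} {k : ℕ}

/-- The tuples `t` and `s` are images of one tuple over `Z` under maps from `I` and `J`. -/
def CommonPreimage (I : Set (Z → X)) (J : Set (Z → Y)) (t : Fin k → X) (s : Fin k → Y) : Prop :=
  ∃ i ∈ I, ∃ j ∈ J, ∃ u : Fin k → Z, t = i ∘ u ∧ s = j ∘ u

/-- Any point can be brought into the range of a map from `I` without changing the image of a
given `k`-tuple. -/
def Absorbing (k : ℕ) (I : Set (Z → X)) : Prop :=
  ∀ i ∈ I, ∀ (u : Fin k → Z) (x : X), ∃ i' ∈ I, i' ∘ u = i ∘ u ∧ x ∈ Set.range i'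

theorem CommonPreimage.symm {I : Set (Z → X)} {J : Set (Z → Y)} {t : Fin k → X} {s : Fin k → Y}
    (h : CommonPreimage I J t s) : CommonPreimage J I s t := by
  obtain ⟨i, hi, j, hj, u, ht, hs⟩ := h
  exact ⟨j, hj, i, hi, u, hs, ht⟩

/-- The answer is the `j`-image of a preimage of `x`. It does not depend on the position `a`, as
matching a whole vector of refined colors requires. -/
theorem CommonPreimage.forth {I : Set (Z → X)} {J : Set (Z → Y)} (hI : Absorbing k I)
    {t : Fin k → X} {s : Fin k → Y} (h : CommonPreimage I J t s) (x : X) :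
    ∃ y, ∀ a, CommonPreimage I J (Function.update t a x) (Function.update s a y) := by
  obtain ⟨i, hi, j, hj, u, rfl, rfl⟩ := h
  obtain ⟨i', hi', hu, z, rfl⟩ := hI i hi u x
  exact ⟨j z, fun a => ⟨i', hi', j, hj, Function.update u a z,
    by rw [← hu, Function.comp_update], by rw [Function.comp_update]⟩⟩

theorem CommonPreimage.back {I : Set (Z → X)} {J : Set (Z → Y)} (hJ : Absorbing k J)
    {t : Fin k → X} {s : Fin k → Y} (h : CommonPreimage I J t s) (y : Y) :
    ∃ x, ∀ a, CommonPreimage I J (Function.update t a x) (Function.update s a y) := by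
  obtain ⟨x, hx⟩ := h.symm.forth hJ y
  exact ⟨x, fun a => (hx a).symm⟩

theorem CommonPreimage.exists_left {I : Set (Z → X)} {J : Set (Z → Y)} (hI : Absorbing k I)
    (hI₀ : I.Nonempty) (hJ₀ : J.Nonempty) [Nonempty Z] (t : Fin k → X) :
    ∃ s, CommonPreimage I J t s := by
  -- Starting from a constant tuple, the entries of `t` are installed one at a time by `forth`.
  suffices h : ∀ S : Finset (Fin k), ∃ t' s, (∀ a ∈ S, t' a = t a) ∧ CommonPreimage I J t' s by
    obtain ⟨t', s, ht, h'⟩ := h Finset.univ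
    obtain rfl : t' = t := funext fun a => ht a (Finset.mem_univ a)
    exact ⟨s, h'⟩
  intro S
  induction S using Finset.induction_on with
  | empty =>
    obtain ⟨i, hi⟩ := hI₀
    obtain ⟨j, hj⟩ := hJ₀
    obtain ⟨z⟩ := ‹Nonempty Z›
    exact ⟨_, _, by simp, i, hi, j, hj, fun _ => z, rfl, rfl⟩
  | insert b S _ ih =>
    obtain ⟨t', s, ht, h⟩ := ih
    obtain ⟨y, hy⟩ := h.forth hI (t b)
    refine ⟨_, _, fun a ha => ?_, hy b⟩
    rcases eq_or_ne a b with rfl | hab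
    · simp
    · rw [Function.update_of_ne hab, ht a (Finset.mem_of_mem_insert_of_ne ha hab)]

end BackAndForth

section Coloring

universe u v

variable {X Y Z : Type u} {C : Type v} {k : ℕ}

theorem CommonPreimage.color_eq {I : Set (Z → X)} {J : Set (Z → Y)} (hI : Absorbing k I)
    (hJ : Absorbing k J) {χX : (Fin k → X) → C} {χY : (Fin k → Y) → C}
    (hχ : ∀ i ∈ I, ∀ j ∈ J, ∀ u : Fin k → Z, χX (i ∘ u) = χY (j ∘ u)) (r : ℕ) :
    ∀ {t : Fin k → X} {s : Fin k → Y}, CommonPreimage I J t s →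
      color χX r t = color χY r s := by
  induction r with
  | zero =>
    rintro _ _ ⟨i, hi, j, hj, u, rfl, rfl⟩
    exact hχ i hi j hj u
  | succ r ih =>
    intro t s h
    refine Prod.ext (ih h) (Set.Subset.antisymm ?_ ?_)
    · rintro _ ⟨x, rfl⟩
      obtain ⟨y, hy⟩ := h.forth hI x
      exact ⟨y, funext fun a => (ih (hy a)).symm⟩
    · rintro _ ⟨y, rfl⟩
      obtain ⟨x, hx⟩ := h.back hJ y
      exact ⟨x, funext fun a => ih (hx a)⟩

theorem not_colorSetsDiffer_of_absorbing {I : Set (Z → X)} {J : Set (Z → Y)}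
    (hI : Absorbing k I) (hJ : Absorbing k J) (hI₀ : I.Nonempty) (hJ₀ : J.Nonempty) [Nonempty Z]
    {χX : (Fin k → X) → C} {χY : (Fin k → Y) → C}
    (hχ : ∀ i ∈ I, ∀ j ∈ J, ∀ u : Fin k → Z, χX (i ∘ u) = χY (j ∘ u)) :
    ¬ ColorSetsDiffer χX χY := by
  rintro ⟨r, hr⟩
  refine hr (Set.Subset.antisymm ?_ ?_)
  · rintro _ ⟨t, rfl⟩
    obtain ⟨s, h⟩ := CommonPreimage.exists_left hI hI₀ hJ₀ t
    exact ⟨s, (h.color_eq hI hJ hχ r).symm⟩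
  · rintro _ ⟨s, rfl⟩
    obtain ⟨t, h⟩ := CommonPreimage.exists_left hJ hJ₀ hI₀ s
    exact ⟨t, h.symm.color_eq hI hJ hχ r⟩

theorem ColorSetsDiffer.symm {χX : (Fin k → X) → C} {χY : (Fin k → Y) → C}
    (h : ColorSetsDiffer χX χY) : ColorSetsDiffer χY χX :=
  h.imp fun _ => Ne.symm

theorem Distinguishes.symm {J : Version} {k : ℕ} {G H : Type u} [Group G] [Group H]
    (h : Distinguishes J k G H) : Distinguishes J k H G := by
  cases J <;> exact h.imp Ne.symm ColorSetsDiffer.symm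

end Coloring

/-! ### Initial colors and injective homomorphisms -/

section Injective

universe u

variable {K G : Type u} [Group K] [Group G] {k : ℕ} {i : K →* G}

theorem initialColorI_comp (hi : Function.Injective i) (u : Fin k → K) :
    initialColorI k G (i ∘ u) = initialColorI k K u := by
  simp [initialColorI, ← map_mul, hi.eq_iff]

theorem initialColorII_comp (hi : Function.Injective i) (u : Fin k → K) :
    initialColorII k G (i ∘ u) = initialColorII k K u := by
  symm
  rw [initialColorII_eq_iff]
  have h : (Subgroup.closure (Set.range u)).map i = Subgroup.closure (Set.range (i ∘ u)) := by
    rw [MonoidHom.map_closure, Set.range_comp]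
  exact ⟨((Subgroup.closure (Set.range u)).equivMapOfInjective i hi).trans
    (MulEquiv.subgroupCongr h), fun _ => rfl⟩

/-- The map on vertices of the gadget graphs induced by a map of groups. -/
def GadgetVertex.map {K G : Type*} (i : K → G) : GadgetVertex K → GadgetVertex G
  | .elt g => .elt (i g)
  | .a g h => .a (i g) (i h)
  | .b g h => .b (i g) (i h)
  | .c g h => .c (i g) (i h)
  | .d g h => .d (i g) (i h)

theorem GadgetVertex.map_injective (hi : Function.Injective i) :
    Function.Injective (GadgetVertex.map i) := by
  rintro (_ | _ | _ | _ | _) (_ | _ | _ | _ | _) h <;> simp_all [GadgetVertex.map, hi.eq_iff]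

theorem GadgetEdge.map {x y : GadgetVertex K} (h : GadgetEdge x y) (i : K →* G) :
    GadgetEdge (x.map i) (y.map i) := by
  cases h
  case prod g h => simpa [GadgetVertex.map] using GadgetEdge.prod (i g) (i h)
  all_goals constructor

theorem gadgetEdge_map_iff (hi : Function.Injective i) {x y : GadgetVertex K} :
    GadgetEdge (x.map i) (y.map i) ↔ GadgetEdge x y := by
  refine ⟨fun h => ?_, fun h => h.map i⟩
  generalize hx : x.map i = x', hy : y.map i = y' at h
  cases h <;> cases x <;> cases y <;>
    simp only [GadgetVertex.map, GadgetVertex.elt.injEq, GadgetVertex.a.injEq,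
      GadgetVertex.b.injEq, GadgetVertex.c.injEq, GadgetVertex.d.injEq, reduceCtorEq] at hx hy
  -- Only product edges need multiplicativity: injectivity cancels `i` in `i x = i (y * z)`.
  case prod.elt.d g h x y z =>
    obtain ⟨rfl, rfl⟩ := hy
    rw [← map_mul] at hx
    obtain rfl := hi hx
    exact .prod y z
  all_goals
    (try obtain ⟨hx, hx'⟩ := hx)
    (try obtain ⟨hy, hy'⟩ := hy)
    subst_vars
    simp only [hi.eq_iff] at *
    subst_vars
    constructor

theorem initialColorIII_comp (hi : Function.Injective i) (u : Fin k → GadgetVertex K) :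
    initialColorIII k G (GadgetVertex.map i ∘ u) = initialColorIII k K u := by
  simp [initialColorIII, gadgetGraph, gadgetEdge_map_iff hi, (GadgetVertex.map_injective hi).eq_iff]

end Injective

/-! ### Split embeddings -/

section Split

variable {A P G : Type*} [AddCommGroup A] [AddCommGroup P] [Group G]

/-- The embeddings of `A` as a direct factor of `G` with complement isomorphic to `P`. -/
def splitEmbeddings (A P G : Type*) [AddCommGroup A] [AddCommGroup P] [Group G] :
    Set (Multiplicative A →* G) :=
  {i | ∃ e : Multiplicative (A × P) ≃* G, ∀ a : A, i (.ofAdd a) = e (.ofAdd (a, 0))}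

theorem splitEmbeddings_nonempty (e : Multiplicative (A × P) ≃* G) :
    (splitEmbeddings A P G).Nonempty :=
  ⟨e.toMonoidHom.comp (AddMonoidHom.toMultiplicative (AddMonoidHom.inl A P)), e, fun _ => rfl⟩

theorem injective_of_mem_splitEmbeddings {i : Multiplicative A →* G}
    (hi : i ∈ splitEmbeddings A P G) : Function.Injective i := by
  obtain ⟨e, he⟩ := hi
  intro a b h
  have := (he a.toAdd).symm.trans (h.trans (he b.toAdd))
  simpa using this

/-- Any element of `A × P` can be moved into `A` by an automorphism that fixes a given set of at
most `N` elements of `A`. -/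
def AbsorbsFactor (N : ℕ) (A P : Type*) [AddCommGroup A] [AddCommGroup P] : Prop :=
  ∀ S : Finset A, S.card ≤ N → ∀ x : A × P, ∃ γ : A × P ≃+ A × P,
    (∀ s ∈ S, γ (s, 0) = (s, 0)) ∧ (γ x).2 = 0

/-- Precomposing the splitting `e` with `γ⁻¹` turns a motion of the point into a change of
embedding. -/
theorem AbsorbsFactor.exists_splitEmbedding {N : ℕ} (h : AbsorbsFactor N A P)
    {i : Multiplicative A →* G} (hi : i ∈ splitEmbeddings A P G) (S : Finset A) (hS : S.card ≤ N)
    (x : G) : ∃ i' ∈ splitEmbeddings A P G, (∀ s ∈ S, i' (.ofAdd s) = i (.ofAdd s)) ∧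
      ∃ a : A, i' (.ofAdd a) = x := by
  obtain ⟨e, he⟩ := hi
  obtain ⟨γ, hγ, hx⟩ := h S hS (e.symm x).toAdd
  let e' : Multiplicative (A × P) ≃* G := (AddEquiv.toMultiplicative γ.symm).trans e
  refine ⟨e'.toMonoidHom.comp (AddMonoidHom.toMultiplicative (AddMonoidHom.inl A P)),
    ⟨e', fun _ => rfl⟩, fun s hs => ?_, (γ (e.symm x).toAdd).1, ?_⟩
  · rw [he]
    change e (.ofAdd (γ.symm (s, 0))) = _
    rw [γ.symm_apply_eq.2 (hγ s hs).symm]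
  · change e (.ofAdd (γ.symm ((γ (e.symm x).toAdd).1, 0))) = _
    rw [← hx, Prod.mk.eta, γ.symm_apply_apply]
    simp

theorem AbsorbsFactor.absorbing {k : ℕ} (h : AbsorbsFactor k A P) :
    Absorbing k ((fun i : Multiplicative A →* G => (i : Multiplicative A → G)) ''
      splitEmbeddings A P G) := by
  classical
  rintro _ ⟨i, hi, rfl⟩ u x
  obtain ⟨i', hi', hS, a, rfl⟩ := h.exists_splitEmbedding hi
    (Finset.univ.image fun j => (u j).toAdd) (Finset.card_image_le.trans (by simp)) x
  exact ⟨i', ⟨i', hi', rfl⟩,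
    funext fun j => hS _ (Finset.mem_image_of_mem _ (Finset.mem_univ j)), _, rfl⟩

/-- The first group element that a vertex of the gadget graph involves. -/
def GadgetVertex.fst {G : Type*} : GadgetVertex G → G
  | .elt g => g
  | .a g _ | .b g _ | .c g _ | .d g _ => g

/-- The second group element that a vertex of the gadget graph involves. -/
def GadgetVertex.snd {G : Type*} : GadgetVertex G → G
  | .elt g => g
  | .a _ h | .b _ h | .c _ h | .d _ h => h

theorem GadgetVertex.map_congr {K G : Type*} {i j : K → G} {x : GadgetVertex K}
    (h₁ : i x.fst = j x.fst) (h₂ : i x.snd = j x.snd) : x.map i = x.map j := by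
  cases x <;> simp_all [GadgetVertex.map, GadgetVertex.fst, GadgetVertex.snd]

theorem GadgetVertex.mem_range_map {K G : Type*} {i : K → G} {x : GadgetVertex G}
    (h₁ : x.fst ∈ Set.range i) (h₂ : x.snd ∈ Set.range i) :
    x ∈ Set.range (GadgetVertex.map i) := by
  obtain ⟨g, hg⟩ := h₁
  obtain ⟨h, hh⟩ := h₂
  cases x
  · exact ⟨.elt g, congrArg _ hg⟩
  · exact ⟨.a g h, congrArg₂ _ hg hh⟩
  · exact ⟨.b g h, congrArg₂ _ hg hh⟩
  · exact ⟨.c g h, congrArg₂ _ hg hh⟩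
  · exact ⟨.d g h, congrArg₂ _ hg hh⟩

/-- A vertex involves up to two group elements, so `k` vertices give `2 * k` elements to fix. The
new vertex is absorbed in two moves, and the second must also fix the element gained by the first.
-/
theorem AbsorbsFactor.absorbing_gadgetVertex {k : ℕ} (h : AbsorbsFactor (2 * k + 1) A P) :
    Absorbing k ((fun i : Multiplicative A →* G => GadgetVertex.map i) ''
      splitEmbeddings A P G) := by
  classical
  rintro _ ⟨i, hi, rfl⟩ u x
  let S : Finset A := (Finset.univ.image fun j => (u j).fst.toAdd) ∪
    (Finset.univ.image fun j => (u j).snd.toAdd)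
  have hS : S.card ≤ 2 * k := by
    refine (Finset.card_union_le _ _).trans ?_
    have h₁ := Finset.card_image_le (s := Finset.univ) (f := fun j => (u j).fst.toAdd)
    have h₂ := Finset.card_image_le (s := Finset.univ) (f := fun j => (u j).snd.toAdd)
    simp only [Finset.card_univ, Fintype.card_fin] at h₁ h₂
    omega
  obtain ⟨i₁, hi₁, hS₁, a, ha⟩ := h.exists_splitEmbedding hi S (by omega) x.fst
  obtain ⟨i₂, hi₂, hS₂, b, hb⟩ := h.exists_splitEmbedding hi₁ (insert a S)
    ((Finset.card_insert_le _ _).trans (by omega)) x.snd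
  have hS₃ : ∀ s ∈ S, i₂ (.ofAdd s) = i (.ofAdd s) := fun s hs =>
    (hS₂ s (Finset.mem_insert_of_mem hs)).trans (hS₁ s hs)
  refine ⟨_, ⟨i₂, hi₂, rfl⟩, funext fun j => GadgetVertex.map_congr ?_ ?_,
    GadgetVertex.mem_range_map ⟨.ofAdd a, ?_⟩ ⟨.ofAdd b, hb⟩⟩
  · exact hS₃ _ (Finset.mem_union_left _ (Finset.mem_image_of_mem _ (Finset.mem_univ j)))
  · exact hS₃ _ (Finset.mem_union_right _ (Finset.mem_image_of_mem _ (Finset.mem_univ j)))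
  · exact (hS₂ a (Finset.mem_insert_self _ _)).trans ha

end Split

section NotDistinguish

variable {A P Q G H : Type} [AddCommGroup A] [AddCommGroup P] [AddCommGroup Q] [Group G] [Group H]
  {k : ℕ}

theorem not_distinguishes_I (e : Multiplicative (A × P) ≃* G) (f : Multiplicative (A × Q) ≃* H)
    (hcard : Nat.card G = Nat.card H) (hP : AbsorbsFactor k A P) (hQ : AbsorbsFactor k A Q) :
    ¬ Distinguishes .I k G H := by
  rintro (h | h)
  · exact h hcard
  refine not_colorSetsDiffer_of_absorbing hP.absorbing hQ.absorbing
    ((splitEmbeddings_nonempty e).image _) ((splitEmbeddings_nonempty f).image _) ?_ h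
  rintro _ ⟨i, hi, rfl⟩ _ ⟨j, hj, rfl⟩ u
  rw [initialColorI_comp (injective_of_mem_splitEmbeddings hi),
    initialColorI_comp (injective_of_mem_splitEmbeddings hj)]

theorem not_distinguishes_II (e : Multiplicative (A × P) ≃* G) (f : Multiplicative (A × Q) ≃* H)
    (hcard : Nat.card G = Nat.card H) (hP : AbsorbsFactor k A P) (hQ : AbsorbsFactor k A Q) :
    ¬ Distinguishes .II k G H := by
  rintro (h | h)
  · exact h hcard
  refine not_colorSetsDiffer_of_absorbing hP.absorbing hQ.absorbing
    ((splitEmbeddings_nonempty e).image _) ((splitEmbeddings_nonempty f).image _) ?_ h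
  rintro _ ⟨i, hi, rfl⟩ _ ⟨j, hj, rfl⟩ u
  rw [initialColorII_comp (injective_of_mem_splitEmbeddings hi),
    initialColorII_comp (injective_of_mem_splitEmbeddings hj)]

theorem not_distinguishes_III (e : Multiplicative (A × P) ≃* G) (f : Multiplicative (A × Q) ≃* H)
    (hcard : Nat.card G = Nat.card H) (hP : AbsorbsFactor (2 * k + 1) A P)
    (hQ : AbsorbsFactor (2 * k + 1) A Q) : ¬ Distinguishes .III k G H := by
  rintro (h | h)
  · exact h hcard
  have : Nonempty (GadgetVertex (Multiplicative A)) := ⟨.elt 1⟩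
  refine not_colorSetsDiffer_of_absorbing hP.absorbing_gadgetVertex hQ.absorbing_gadgetVertex
    ((splitEmbeddings_nonempty e).image _) ((splitEmbeddings_nonempty f).image _) ?_ h
  rintro _ ⟨i, hi, rfl⟩ _ ⟨j, hj, rfl⟩ u
  rw [initialColorIII_comp (injective_of_mem_splitEmbeddings hi),
    initialColorIII_comp (injective_of_mem_splitEmbeddings hj)]

end NotDistinguish

/-! ### Absorbing factors of exponent two and four -/

section Swap

variable {A P C : Type*} [AddCommGroup A] [AddCommGroup P] [AddCommGroup C]

/-- The automorphism of `A × P` that swaps two copies of a common direct summand `C`. -/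
def swapSummand (l : A →+ C) (s : C →+ A) (r : P →+ C) (t : C →+ P) (hl : ∀ c, l (s c) = c)
    (hr : ∀ c, r (t c) = c) : A × P ≃+ A × P where
  -- An involution: it exchanges the values `l x.1` and `r x.2` and leaves the kernel parts alone.
  toFun x := (x.1 + s (r x.2 - l x.1), x.2 + t (l x.1 - r x.2))
  invFun x := (x.1 + s (r x.2 - l x.1), x.2 + t (l x.1 - r x.2))
  left_inv x := by
    ext <;> simp [hl, hr] <;> abel
  right_inv x := by
    ext <;> simp [hl, hr] <;> abel
  map_add' x y := by
    ext <;> simp <;> abel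

end Swap

/-- A small set of vectors over `ZMod q` is annihilated by a split linear functional. -/
theorem exists_functional {q m : ℕ} [NeZero q] (S : Finset (Fin m → ZMod q))
    (hS : q ^ S.card < 2 ^ m) : ∃ (l : (Fin m → ZMod q) →+ ZMod q)
      (s : ZMod q →+ (Fin m → ZMod q)), (∀ c, l (s c) = c) ∧ ∀ x ∈ S, l x = 0 := by
  -- Pigeonhole on 0/1 vectors: two of them have equal dot products with all of `S`. Their
  -- difference has an entry ±1, a unit even when `q` is not prime, so its functional splits.
  let F (a : Fin m → Bool) : Fin m → ZMod q := fun j => if a j then 1 else 0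
  obtain ⟨a, b, hab, h⟩ := Fintype.exists_ne_map_eq_of_card_lt
    (fun (a : Fin m → Bool) (x : S) => F a ⬝ᵥ x.1) (by simpa [ZMod.card] using hS)
  obtain ⟨j, hj⟩ := Function.ne_iff.1 hab
  let w := F a - F b
  have hw : w j * w j = 1 := by
    cases ha : a j <;> cases hb : b j <;> simp_all [w, F]
  refine ⟨AddMonoidHom.mk' (fun x => w ⬝ᵥ x) fun x y => dotProduct_add _ _ _,
    AddMonoidHom.mk' (fun c => Pi.single j (w j * c)) fun c d => ?_, fun c => ?_, fun x hx => ?_⟩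
  · rw [mul_add, Pi.single_add]
  · simp [← mul_assoc, hw]
  · have := congrFun h ⟨x, hx⟩
    simp only at this
    simp [w, sub_dotProduct, this]

/-- The functional kills `S` and also the `A`-part of the point, hence the exponent `N + 1`. The
swap then fixes `S` and carries the `P`-part, which lies in the cyclic summand, into `A`. -/
theorem absorbsFactor_of_functional {A P : Type*} [AddCommGroup A] [AddCommGroup P]
    {N q m : ℕ} [NeZero q] (f : A →+ (Fin m → ZMod q)) (g : (Fin m → ZMod q) →+ A)
    (hfg : ∀ x, f (g x) = x) (hN : q ^ (N + 1) < 2 ^ m)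
    (hP : ∀ p : P, ∃ (r : P →+ ZMod q) (t : ZMod q →+ P), (∀ c, r (t c) = c) ∧ p ∈ Set.range t) :
    AbsorbsFactor N A P := by
  classical
  rintro S hS ⟨w, p⟩
  obtain ⟨r, t, hr, c, rfl⟩ := hP p
  obtain ⟨l, s, hl, hl₀⟩ := exists_functional ((insert w S).image f)
    ((Nat.pow_le_pow_right (NeZero.pos q) (Finset.card_image_le.trans
      ((Finset.card_insert_le _ _).trans (by omega)))).trans_lt hN)
  refine ⟨swapSummand (l.comp f) (g.comp s) r t (by simp [hfg, hl]) hr, fun x hx => ?_, ?_⟩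
  · have := hl₀ (f x) (Finset.mem_image_of_mem _ (Finset.mem_insert_of_mem hx))
    simp [swapSummand, this]
  · have := hl₀ (f w) (Finset.mem_image_of_mem _ (Finset.mem_insert_self _ _))
    simp [swapSummand, this, hr]

theorem absorbsFactor_zmod_two {N m j : ℕ} [NeZero j] {B : Type*} [AddCommGroup B]
    (hN : N + 1 < m) : AbsorbsFactor N ((Fin m → ZMod 2) × B) (Fin j → ZMod 2) := by
  refine absorbsFactor_of_functional (AddMonoidHom.fst _ _) (AddMonoidHom.inl _ _) (fun _ => rfl)
    (Nat.pow_lt_pow_right (by norm_num) hN) fun p => ?_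
  by_cases hp : p = 0
  · exact ⟨Pi.evalAddMonoidHom _ 0, AddMonoidHom.single (fun _ => ZMod 2) 0, by simp, 0, by simp [hp]⟩
  -- A nonzero vector over `ZMod 2` spans a summand, split by any coordinate at which it equals 1.
  · obtain ⟨a, ha⟩ := Function.ne_iff.1 hp
    have ha : p a = 1 := by
      have h₁ : ∀ z : ZMod 2, z ≠ 0 → z = 1 := by decide
      exact h₁ _ ha
    exact ⟨Pi.evalAddMonoidHom _ a,
      AddMonoidHom.mk' (fun c => c • p) fun c d => add_smul _ _ _, by simp [ha], 1, by simp⟩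

theorem absorbsFactor_zmod_four {N m : ℕ} {B : Type*} [AddCommGroup B] (hN : 2 * (N + 1) < m) :
    AbsorbsFactor N (B × (Fin m → ZMod 4)) (Fin 1 → ZMod 4) := by
  refine absorbsFactor_of_functional (AddMonoidHom.snd _ _) (AddMonoidHom.inr _ _) (fun _ => rfl)
    ?_ fun p => ?_
  · calc 4 ^ (N + 1) = 2 ^ (2 * (N + 1)) := by rw [pow_mul]; rfl
      _ < 2 ^ m := Nat.pow_lt_pow_right (by norm_num) hN
  · exact ⟨Pi.evalAddMonoidHom _ 0, AddMonoidHom.single (fun _ => ZMod 4) 0, by simp, p 0, by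
      ext a; simp [Subsingleton.elim a 0]⟩

/-! ### The two families of groups -/

/-- Splitting off the last `j` coordinates. -/
def appendAddEquiv (R : Type*) [AddCommGroup R] (m j : ℕ) :
    (Fin m → R) × (Fin j → R) ≃+ (Fin (m + j) → R) :=
  AddEquiv.mk' (Fin.appendEquiv m j) fun x y => by
    ext a
    refine Fin.addCases (fun b => ?_) (fun b => ?_) a <;> simp [Fin.appendEquiv]

/-- `(ℤ/2)^m × (ℤ/4)^l` is a direct factor of `(ℤ/2)^(m+j) × (ℤ/4)^l`. -/
def splitTwo (m l j : ℕ) : Multiplicative (((Fin m → ZMod 2) × (Fin l → ZMod 4)) ×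
    (Fin j → ZMod 2)) ≃* TwoFourGroup (m + j) l :=
  AddEquiv.toMultiplicative
    { toFun := fun x => (appendAddEquiv _ m j (x.1.1, x.2), x.1.2)
      invFun := fun y => ((((appendAddEquiv _ m j).symm y.1).1, y.2),
        ((appendAddEquiv _ m j).symm y.1).2)
      left_inv := fun x => by simp
      right_inv := fun y => by simp
      map_add' := fun x y => Prod.ext (map_add (appendAddEquiv _ m j) (x.1.1, x.2) (y.1.1, y.2)) rfl }

/-- `(ℤ/2)^m × (ℤ/4)^l` is a direct factor of `(ℤ/2)^m × (ℤ/4)^(l+j)`. -/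
def splitFour (m l j : ℕ) : Multiplicative (((Fin m → ZMod 2) × (Fin l → ZMod 4)) ×
    (Fin j → ZMod 4)) ≃* TwoFourGroup m (l + j) :=
  AddEquiv.toMultiplicative
    (AddEquiv.prodAssoc.trans ((AddEquiv.refl _).prodCongr (appendAddEquiv _ l j)))

theorem card_twoFourGroup (m l : ℕ) : Nat.card (TwoFourGroup m l) = 2 ^ (m + 2 * l) := by
  simp [TwoFourGroup, pow_add, pow_mul]

/-- This isomorphism invariant separates the two groups: the exponent is 2n for G_n and 2n - 1 for
H_n. -/
theorem card_twoTorsion_twoFourGroup (m l : ℕ) :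
    Nat.card {x : TwoFourGroup m l // x * x = 1} = 2 ^ (m + l) := by
  have h₂ : ∀ z : ZMod 2, z + z = 0 := by decide
  have h₄ : Fintype.card {z : ZMod 4 // z + z = 0} = 2 := by decide
  let e : {x : TwoFourGroup m l // x * x = 1} ≃
      (Fin m → ZMod 2) × (Fin l → {z : ZMod 4 // z + z = 0}) :=
    { toFun := fun x => (x.1.toAdd.1, fun a => ⟨x.1.toAdd.2 a,
        congrFun (congrArg Prod.snd (congrArg Multiplicative.toAdd x.2)) a⟩)
      invFun := fun y => ⟨.ofAdd (y.1, fun a => (y.2 a).1),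
        Multiplicative.toAdd.injective
          (Prod.ext (funext fun a => h₂ (y.1 a)) (funext fun a => (y.2 a).2))⟩
      left_inv := fun _ => rfl
      right_inv := fun _ => rfl }
  rw [Nat.card_congr e]
  simp [pow_add, h₄]

theorem isEmpty_mulEquiv_twoFourGroup {m l m' l' : ℕ} (h : m + l ≠ m' + l') :
    IsEmpty (TwoFourGroup m l ≃* TwoFourGroup m' l') := by
  refine ⟨fun e => h ?_⟩
  have := Nat.card_congr (e.toEquiv.subtypeEquiv (p := fun x => x * x = 1)
    (q := fun x => x * x = 1) fun x => by
      change x * x = 1 ↔ e x * e x = 1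
      rw [← map_mul, map_eq_one_iff e e.injective])
  rw [card_twoTorsion_twoFourGroup, card_twoTorsion_twoFourGroup] at this
  exact Nat.pow_right_injective le_rfl this

theorem card_groupH {n : ℕ} (hn : 5 ≤ n) : Nat.card (GroupH n) = Nat.card (GroupG n) := by
  rw [card_twoFourGroup, card_twoFourGroup]
  congr 1
  omega

theorem not_distinguishes_groupG_groupH {n k : ℕ} (hn : 5 ≤ n) :
    (4 * k ≤ n → ¬ Distinguishes .I k (GroupG n) (GroupH n)) ∧
    (4 * k ≤ n → ¬ Distinguishes .II k (GroupG n) (GroupH n)) ∧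
    (4 * k + 4 < n → ¬ Distinguishes .III k (GroupG n) (GroupH n)) := by
  -- The common factor is (ℤ/2)^m × (ℤ/4)^(m+2). The requirements k + 1 < n - 2 and 2(k + 1) < n
  -- both follow from 4k ≤ n and n ≥ 5.
  obtain ⟨m, rfl⟩ : ∃ m, n = m + 2 := ⟨n - 2, by omega⟩
  have hcard : Nat.card (GroupG (m + 2)) = Nat.card (GroupH (m + 2)) :=
    (card_groupH hn).symm
  have hP {N : ℕ} (hN : N + 1 < m) :
      AbsorbsFactor N ((Fin m → ZMod 2) × (Fin (m + 2) → ZMod 4)) (Fin 2 → ZMod 2) :=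
    absorbsFactor_zmod_two hN
  have hQ {N : ℕ} (hN : 2 * (N + 1) < m + 2) :
      AbsorbsFactor N ((Fin m → ZMod 2) × (Fin (m + 2) → ZMod 4)) (Fin 1 → ZMod 4) :=
    absorbsFactor_zmod_four hN
  refine ⟨fun hk => ?_, fun hk => ?_, fun hk => ?_⟩
  · exact not_distinguishes_I (splitTwo m (m + 2) 2) (splitFour m (m + 2) 1) hcard
      (hP (by omega)) (hQ (by omega))
  · exact not_distinguishes_II (splitTwo m (m + 2) 2) (splitFour m (m + 2) 1) hcard
      (hP (by omega)) (hQ (by omega))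
  · exact not_distinguishes_III (splitTwo m (m + 2) 2) (splitFour m (m + 2) 1) hcard
      (hP (by omega)) (hQ (by omega))

theorem le_of_distinguishes_groupG_groupH {n k : ℕ} (hn : 5 ≤ n) {J : Version}
    (h : Distinguishes J k (GroupG n) (GroupH n)) : n ≤ 8 * k := by
  obtain ⟨h₁, h₂, h₃⟩ := not_distinguishes_groupG_groupH (k := k) hn
  by_contra hk
  cases J
  · exact h₁ (by omega) h
  · exact h₂ (by omega) h
  -- From 8k < n one gets 4k + 4 < n: for k = 0 this is n ≥ 5, and otherwise 4k + 4 ≤ 8k.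
  · exact h₃ (by omega) h

theorem isEmpty_groupG_mulEquiv_groupH {n : ℕ} (hn : 5 ≤ n) :
    IsEmpty (GroupG n ≃* GroupH n) :=
  isEmpty_mulEquiv_twoFourGroup (by omega)

end CountFreeWL

theorem mainTheorem4 :
    (∀ n : ℕ, 5 ≤ n →
      Nat.card (CountFreeWL.GroupG n) = Nat.card (CountFreeWL.GroupH n) ∧
      IsEmpty (CountFreeWL.GroupG n ≃* CountFreeWL.GroupH n) ∧
      ∀ k : ℕ, (k : ℝ) ≤ (n : ℝ) / 4 →
        ¬ CountFreeWL.Distinguishes CountFreeWL.Version.II k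
            (CountFreeWL.GroupG n) (CountFreeWL.GroupH n)) ∧
    ∃ c : ℝ, 0 < c ∧ ∀ n : ℕ, 5 ≤ n → ∀ (J : CountFreeWL.Version) (k : ℕ),
      (CountFreeWL.Distinguishes J k (CountFreeWL.GroupG n) (CountFreeWL.GroupH n) →
        c * Real.log (Nat.card (CountFreeWL.GroupG n)) ≤ (k : ℝ)) ∧
      (CountFreeWL.Identifies J k (CountFreeWL.GroupG n) →
        c * Real.log (Nat.card (CountFreeWL.GroupG n)) ≤ (k : ℝ)) ∧
      (CountFreeWL.Identifies J k (CountFreeWL.GroupH n) →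
        c * Real.log (Nat.card (CountFreeWL.GroupH n)) ≤ (k : ℝ)) := by
  have hlog : 0 < Real.log 2 := Real.log_pos one_lt_two
  refine ⟨fun n hn => ⟨(CountFreeWL.card_groupH hn).symm,
    CountFreeWL.isEmpty_groupG_mulEquiv_groupH hn, fun k hk => ?_⟩,
    -- Here log |G_n| = 3n log 2 and n ≤ 8k, whence 24 = 3 · 8.
    1 / (24 * Real.log 2), by positivity, fun n hn J k => ?_⟩
  · refine (CountFreeWL.not_distinguishes_groupG_groupH hn).2.1 ?_
    have : (4 * k : ℝ) ≤ n := by linarith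
    exact_mod_cast this
  · have key (h : CountFreeWL.Distinguishes J k (CountFreeWL.GroupG n) (CountFreeWL.GroupH n)) :
        1 / (24 * Real.log 2) * Real.log (Nat.card (CountFreeWL.GroupG n)) ≤ (k : ℝ) := by
      have hk : (n : ℝ) ≤ 8 * k :=
        mod_cast CountFreeWL.le_of_distinguishes_groupG_groupH hn h
      have : 1 / (24 * Real.log 2) * Real.log (Nat.card (CountFreeWL.GroupG n)) = n / 8 := by
        rw [CountFreeWL.card_twoFourGroup]
        push_cast
        rw [Real.log_pow]
        push_cast
        field_simp
        ring
      linarith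
    have hGH := CountFreeWL.isEmpty_groupG_mulEquiv_groupH hn
    refine ⟨key, fun h => key (h _ hGH), fun h => ?_⟩
    rw [CountFreeWL.card_groupH hn]
    exact key (h (CountFreeWL.GroupG n) ⟨fun e => hGH.false e.symm⟩).symm
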